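/- Consider weighted set cover with a ground set $\mathcal U$ of $n$ elements and a family $\mathcal S$ of $m$ sets with positive costs $c_S$ that together cover $\mathcal U$, where $mn\ge 2$. Let $c(\mathrm{Opt})$ be the minimum cost of a set cover, let $\kappa_e=\min_{S\ni e}c_S$, and let $\mathrm{Est}$ be a given estimate with $c(\mathrm{Opt})\le \mathrm{Est}\le 2c(\mathrm{Opt})$. Put $K=\{p\in[0,1]^{\mathcal S}:\sum_S c_Sp_S\le \mathrm{Est}\}$. For $p\in\mathbb R^{\mathcal S}$ write $\hat p_S=c_Sp_S/\mathrm{Est}$, and let $\mathrm{uKL}(x;z)=\sum_S\big(x_S\log(x_S/z_S)-x_S+z_S\big)$. Fix a step size $\eta\in(0,1]$ (for instance $\eta=\tfrac12$). The algorithm ROSC-OCO starts with no sets bought and with weights $p^1=\operatorname{argmin}_{p\in K}\mathrm{uKL}(\hat p;(\tfrac1m,\dots,\tfrac1m))$. At each time $t=1,\dots,n$: 1. An element $e^t$ arrives, uniformly random among the elements that have not arrived yet. Let $\kappa^t=\kappa_{e^t}$ if no set bought before time $t$ contains $e^t$, and $\kappa^t=0$ otherwise. 2. If $e^t$ is uncovered,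 the algorithm buys a cheapest set containing $e^t$, at cost $\kappa^t$. 3. In addition, it buys each set $S\in\mathcal S$ independently with probability $(\kappa^t/\mathrm{Est})\,p^t_S$. 4. It takes a supergradient $g^t$ at $p^t$ of the concave function $p\mapsto(\kappa^t/\mathrm{Est})\min\big(1,\sum_{S\ni e^t}p_S\big)$ on $\mathbb R^{\mathcal S}$ and sets $$p^{t+1}=\operatorname{argmin}_{p\in K}\Big\{-\langle g^t,p\rangle+\tfrac1\eta\,\mathrm{uKL}(\hat p;\hat p^{\,t})\Big\}.$$ Ties among cheapest sets and among supergradients are broken arbitrarily. **Theorem.** ROSC-OCO is $O(\log(mn))$-competitive for online weighted set cover in random order. That is, for every $\eta\in(0,1]$ there is a constant $C>0$, depending only on $\eta$, such that for every instance, every $\mathrm{Est}$ and every tie-breaking rule as above, the sets bought by the algorithm always form a set cover of cost at most the total amount paid, and $$\mathbb E[\text{total amount paid}]\le C\,\log(mn)\cdot c(\mathrm{Opt}),$$ where every purchase is charged, even if the set had been bought before. -/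

import Mathlib

/-- A weighted set cover instance with ground set `Fin n` and `m` sets of positive cost that
together cover the ground set. -/
structure SetCoverInstance (m n : ℕ) where
  sets : Fin m → Finset (Fin n)
  cost : Fin m → ℝ
  cost_pos : ∀ S, 0 < cost S
  coverable : ∀ e, ∃ S, e ∈ sets S

namespace SetCoverInstance

variable {m n : ℕ}

/-- The total cost of a collection of sets. -/
def costOf (I : SetCoverInstance m n) (F : Finset (Fin m)) : ℝ := ∑ S ∈ F, I.cost S

/-- The element `e` lies in some set of the collection `F`. -/
def Covered (I : SetCoverInstance m n) (F : Finset (Fin m)) (e : Fin n) : Prop :=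
  ∃ S ∈ F, e ∈ I.sets S

instance (I : SetCoverInstance m n) (F : Finset (Fin m)) (e : Fin n) :
    Decidable (I.Covered F e) := by
  unfold Covered; infer_instance

/-- `F` is a set cover: every element lies in some set of `F`. -/
def IsCover (I : SetCoverInstance m n) (F : Finset (Fin m)) : Prop := ∀ e, I.Covered F e

/-- The offline optimum: the least cost of a set cover (a minimum over a finite nonempty set). -/
noncomputable def opt (I : SetCoverInstance m n) : ℝ :=
  sInf {x | ∃ F : Finset (Fin m), I.IsCover F ∧ I.costOf F = x}

/-- The indices of the sets that contain `e`. -/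
def containing (I : SetCoverInstance m n) (e : Fin n) : Finset (Fin m) :=
  Finset.univ.filter fun S => e ∈ I.sets S

theorem containing_nonempty (I : SetCoverInstance m n) (e : Fin n) :
    (I.containing e).Nonempty := by
  obtain ⟨S, hS⟩ := I.coverable e
  exact ⟨S, by simp [containing, hS]⟩

/-- `κ_e`: the cost of the cheapest set that contains `e`. -/
noncomputable def kappa (I : SetCoverInstance m n) (e : Fin n) : ℝ :=
  (I.containing e).inf' (I.containing_nonempty e) I.cost

/-- `κ_e^t`: equal to `κ_e` if `e` is not covered by the sets `F` bought so far, and `0` if it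
is. -/
noncomputable def residual (I : SetCoverInstance m n) (F : Finset (Fin m)) (e : Fin n) : ℝ :=
  if I.Covered F e then 0 else I.kappa e

/-- The admissible weight vectors: `p ∈ [0,1]^m` with `⟨c, p⟩ ≤ Est`. -/
def weightSet (I : SetCoverInstance m n) (Est : ℝ) : Set (Fin m → ℝ) :=
  {p | (∀ S, 0 ≤ p S ∧ p S ≤ 1) ∧ ∑ S, I.cost S * p S ≤ Est}

/-- The linearized gain `(k / Est) * min (1, ∑_{S ∋ e} p_S)` of an element `e` whose current
residual cost is `k`. -/
noncomputable def gain (I : SetCoverInstance m n) (Est k : ℝ) (e : Fin n) (p : Fin m → ℝ) : ℝ :=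
  k / Est * min 1 (∑ S ∈ I.containing e, p S)

/-- The (super)gradients at `p` of a concave function `f`. -/
def supergradients (f : (Fin m → ℝ) → ℝ) (p : Fin m → ℝ) : Set (Fin m → ℝ) :=
  {g | ∀ q, f q ≤ f p + ∑ S, g S * (q S - p S)}

/-- The unnormalized Kullback-Leibler divergence, the Bregman divergence of the unnormalized
entropy `∑ (x log x - x)`. -/
noncomputable def uKL (x z : Fin m → ℝ) : ℝ :=
  ∑ S, (x S * Real.log (x S / z S) - x S + z S)

/-- The linear change of variables `x_S = c_S p_S / Est` that maps the weight vectors into the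
simplex `{x ≥ 0, ∑ x ≤ 1}`. -/
noncomputable def rescale (I : SetCoverInstance m n) (Est : ℝ) (p : Fin m → ℝ) : Fin m → ℝ :=
  fun S => I.cost S * p S / Est

/-- The objective of a mirror descent step with step size `η`, gain gradient `g`, and prox
centre `z` (a point of the rescaled space). The linear term needs no rescaling, since `⟨g, p⟩`
equals the product of the rescaled gradient with the rescaled point. -/
noncomputable def mirrorObjective (I : SetCoverInstance m n) (Est η : ℝ) (z g : Fin m → ℝ)
    (p : Fin m → ℝ) : ℝ :=
  -(∑ S, g S * p S) + 1 / η * uKL (I.rescale Est p) z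

/-- `p` minimizes the mirror descent objective over the admissible weight vectors. -/
def IsMirrorStep (I : SetCoverInstance m n) (Est η : ℝ) (z g : Fin m → ℝ)
    (p : Fin m → ℝ) : Prop :=
  p ∈ I.weightSet Est ∧ IsMinOn (I.mirrorObjective Est η z g) (I.weightSet Est) p

theorem exists_isMirrorStep (I : SetCoverInstance m n) {Est : ℝ} (hEst : 0 ≤ Est) (η : ℝ)
    (z g : Fin m → ℝ) : ∃ p, I.IsMirrorStep Est η z g p := by
  have hclosed : IsClosed (I.weightSet Est) := by
    have : I.weightSet Est = (⋂ S, {p | 0 ≤ p S ∧ p S ≤ 1}) ∩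
        {p | ∑ S, I.cost S * p S ≤ Est} := by
      ext p; simp [weightSet]
    rw [this]
    refine IsClosed.inter (isClosed_iInter fun S => ?_)
      (isClosed_le (by fun_prop) continuous_const)
    exact (isClosed_le continuous_const (continuous_apply S)).inter
      (isClosed_le (continuous_apply S) continuous_const)
  have hcompact : IsCompact (I.weightSet Est) := by
    refine (isCompact_univ_pi (fun _ : Fin m => isCompact_Icc (a := (0 : ℝ)) (b := 1))).of_isClosed_subset
      hclosed ?_
    intro p hp S _
    exact hp.1 S
  have hne : (I.weightSet Est).Nonempty :=
    ⟨0, by simp [weightSet, hEst]⟩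
  have hterm : ∀ a : ℝ, Continuous fun x : ℝ => x * Real.log (x / a) := by
    intro a
    by_cases ha : a = 0
    · simpa [ha] using continuous_const
    · have h : (fun x : ℝ => x * Real.log (x / a)) =
          fun x => a * (x / a * Real.log (x / a)) := by
        funext x; field_simp
      rw [h]
      exact continuous_const.mul
        (Real.continuous_mul_log.comp (continuous_id.div_const a))
  have hcont : Continuous (I.mirrorObjective Est η z g) := by
    unfold mirrorObjective uKL rescale
    refine Continuous.add (by fun_prop) (continuous_const.mul (continuous_finsetSum _ ?_))
    intro S _
    refine Continuous.add (Continuous.sub ?_ (by fun_prop)) continuous_const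
    exact (hterm (z S)).comp (g := fun x : ℝ => x * Real.log (x / z S))
      (f := fun p : Fin m → ℝ => I.cost S * p S / Est) (by fun_prop)
  obtain ⟨p, hp, hmin⟩ := hcompact.exists_isMinOn hne hcont.continuousOn
  exact ⟨p, hp, hmin⟩

/-- The weights produced by a mirror descent step. A minimizer exists for every `Est ≥ 0`, and
it is unique when `z` is positive, `Est > 0` and `η > 0`. -/
noncomputable def mirrorStep (I : SetCoverInstance m n) (Est η : ℝ) (z g : Fin m → ℝ) :
    Fin m → ℝ :=
  Classical.epsilon (I.IsMirrorStep Est η z g)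

/-- The state of the algorithm at the start of a time step: the elements that have not arrived
yet, the sets bought, the amount paid, and the current weights `p^t`. -/
structure State (m n : ℕ) where
  unseen : Finset (Fin n)
  bought : Finset (Fin m)
  paid : ℝ
  weights : Fin m → ℝ

/-- Initially nothing has arrived or been bought; the weights are the mirror descent iterate
obtained from the uniform point `(1/m, …, 1/m)` of the rescaled space by a step with zero
gradient, that is, its Bregman projection. -/
noncomputable def init (I : SetCoverInstance m n) (Est η : ℝ) : State m n where
  unseen := Finset.univ
  bought := ∅
  paid := 0
  weights := I.mirrorStep Est η (fun _ => 1 / (m : ℝ)) 0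

/-- The two free choices of the algorithm, which may depend on its state in any way: which
cheapest set is bought for an uncovered arrival, and which supergradient of the gain function is
used where that function is not differentiable. -/
structure TieBreaking (I : SetCoverInstance m n) (Est : ℝ) where
  backup : State m n → Fin n → Fin m
  backup_mem : ∀ σ e, e ∈ I.sets (backup σ e)
  backup_cost : ∀ σ e, I.cost (backup σ e) = I.kappa e
  grad : State m n → Fin n → Fin m → ℝ
  grad_mem : ∀ σ e,
    grad σ e ∈ supergradients (I.gain Est (I.residual σ.bought e) e) σ.weights

/-- The random collection that contains each `S` independently with probability `q S`
(values outside `[0,1]` are truncated to `[0,1]`). -/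
noncomputable def sampleSets (q : Fin m → ℝ) : PMF (Finset (Fin m)) :=
  PMF.ofFintype
    (fun A => (∏ S ∈ A, min 1 (ENNReal.ofReal (q S))) *
      ∏ S ∈ Aᶜ, (1 - min 1 (ENNReal.ofReal (q S)))) (by
    have h := Finset.prod_add (fun S => min 1 (ENNReal.ofReal (q S)))
      (fun S => 1 - min 1 (ENNReal.ofReal (q S))) (Finset.univ : Finset (Fin m))
    simp only [Finset.powerset_univ] at h
    simp only [Finset.compl_eq_univ_sdiff]
    rw [← h]
    exact Finset.prod_eq_one fun S _ => add_tsub_cancel_of_le (min_le_left _ _))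

/-- The state after element `e` arrived in state `σ` and the sets `A` were sampled. Every
sampled set is paid for, even if it had been bought before. -/
noncomputable def nextState (I : SetCoverInstance m n) (Est η : ℝ) (T : I.TieBreaking Est)
    (σ : State m n) (e : Fin n) (A : Finset (Fin m)) : State m n where
  unseen := σ.unseen.erase e
  bought := σ.bought ∪ (if I.Covered σ.bought e then ∅ else {T.backup σ e}) ∪ A
  paid := σ.paid + I.residual σ.bought e + I.costOf A
  weights := I.mirrorStep Est η (I.rescale Est σ.weights) (T.grad σ e)

/-- One time step: a uniformly random unseen element arrives, it is covered if needed by a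
cheapest set, each set `S` is sampled independently with probability `(κ_e^t / Est) * p_S^t`, and
the weights are updated. -/
noncomputable def step (I : SetCoverInstance m n) (Est η : ℝ) (T : I.TieBreaking Est)
    (σ : State m n) : PMF (State m n) :=
  if h : σ.unseen.Nonempty then
    (PMF.uniformOfFinset σ.unseen h).bind fun e =>
      (sampleSets fun S => I.residual σ.bought e / Est * σ.weights S).map fun A =>
        I.nextState Est η T σ e A
  else PMF.pure σ

/-- The law of the state after `t` time steps. -/
noncomputable def run (I : SetCoverInstance m n) (Est η : ℝ) (T : I.TieBreaking Est) :
    ℕ → PMF (State m n)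
  | 0 => PMF.pure (I.init Est η)
  | t + 1 => (run I Est η T t).bind (I.step Est η T)

/-- The law of the final state of ROSC-OCO, when all `n` elements have arrived. -/
noncomputable def roscOco (I : SetCoverInstance m n) (Est η : ℝ) (T : I.TieBreaking Est) :
    PMF (State m n) :=
  I.run Est η T n

/-- The expected total amount paid. -/
noncomputable def expectedPaid (P : PMF (State m n)) : ENNReal :=
  ∑' σ, P σ * ENNReal.ofReal σ.paid

end SetCoverInstance

namespace SetCoverInstance

variable {m n : ℕ}

/-! The proof exhibits a supermartingale. Fix an optimal cover `F` with indicator `q`. Let Φ be the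
total residual cost of the unseen elements, r their number, and M the sum over them of the
linearized gains at the current weights p. The budget is paid + 2 Est · (D/η + 4 log(1 + Φ/Est) + 2
H_r), where D is the divergence of `q` from p after rescaling and H_r is the harmonic number. Since
the potential is nonnegative, the expected payment is at most the initial budget, which is O(Est ·
log(mn)).

When `e` arrives with residual cost κ, the expected payment is at most 2κ: the sampled sets cost no
more on average than the backup set. The optimal cover has gain κ/Est at `e`, so mirror descent
regret (`Inv.residual_le_divergence_sub`) bounds κ/Est by the drop of D/η plus twice the gain of p
at `e`. Either the divergence pays or p already covers `e` well fractionally.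

The second case is paid for by sampling: it lowers Φ in expectation by at least κM/2, hence the
logarithm by at least κM/(2(Φ + Est)) (`Inv.sum_log_nextState_le`). By random order, the average of
κ over the unseen elements is Φ/r and the average gain is M/r. The unpaid remainder is thus at most
(2/r)(M − ΦM/(Φ + Est)) = (2/r) · M Est/(Φ + Est) ≤ 2/r, because M Est ≤ Φ. This is exactly the drop
of 2 H_r (`Inv.average_budget_le`). The shift by 1 inside the logarithm keeps it finite and
nonnegative when Φ = 0, at the price of this harmonic term. -/

/-! ### Unnormalized KL divergence and mirror steps -/

theorem mul_log_div_sub_add_nonneg {a b : ℝ} (ha : 0 ≤ a) (hb : 0 < b) :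
    0 ≤ a * Real.log (a / b) - a + b := by
  rcases ha.eq_or_lt with rfl | ha
  · simpa using hb.le
  · have h := mul_le_mul_of_nonneg_left (Real.one_sub_inv_le_log_of_pos (div_pos ha hb)) ha.le
    have h2 : a * (1 - (a / b)⁻¹) = a - b := by field_simp
    linarith

theorem mul_log_div_split {a b c : ℝ} (hb : 0 < b) (hc : 0 < c) :
    a * Real.log (a / c) = a * Real.log (a / b) + a * Real.log (b / c) := by
  rcases eq_or_ne a 0 with rfl | ha
  · simp
  · rw [← mul_add, ← Real.log_mul (by positivity) (by positivity)]
    congr 2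
    field_simp

theorem uKL_nonneg {x z : Fin m → ℝ} (hx : ∀ S, 0 ≤ x S) (hz : ∀ S, 0 < z S) :
    0 ≤ uKL x z :=
  Finset.sum_nonneg fun S _ => mul_log_div_sub_add_nonneg (hx S) (hz S)

/-- The Bregman three-point identity: the vector of log(x S / z S) is the gradient of `uKL · z` at
`x`. Coordinates of `y` may vanish. -/
theorem uKL_three_point {x y z : Fin m → ℝ} (hx : ∀ S, 0 < x S) (hz : ∀ S, 0 < z S) :
    ∑ S, Real.log (x S / z S) * (y S - x S) = uKL y z - uKL x z - uKL y x := by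
  simp only [uKL, ← Finset.sum_sub_distrib]
  refine Finset.sum_congr rfl fun S _ => ?_
  rw [mul_log_div_split (a := y S) (hx S) (hz S)]
  ring

/-- Moving from `x` towards `y` changes the divergence from `z` by at most the derivative at the
new point, by convexity. -/
theorem uKL_segment_sub_le {x y z : Fin m → ℝ} {s : ℝ} (hx : ∀ S, 0 ≤ x S) (hz : ∀ S, 0 < z S)
    (hpos : ∀ S, 0 < x S + s * (y S - x S)) :
    uKL (fun S => x S + s * (y S - x S)) z - uKL x z ≤
      s * ∑ S, Real.log ((x S + s * (y S - x S)) / z S) * (y S - x S) := by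
  simp only [uKL, ← Finset.sum_sub_distrib, Finset.mul_sum]
  refine Finset.sum_le_sum fun S _ => ?_
  -- The slack in this coordinate is exactly the divergence term of `x S` from the new point.
  have h1 := mul_log_div_sub_add_nonneg (hx S) (hpos S)
  have h2 := mul_log_div_split (a := x S) (hpos S) (hz S)
  rw [h2]
  linarith

theorem rescale_segment (I : SetCoverInstance m n) (Est : ℝ) (p q : Fin m → ℝ) (s : ℝ) :
    I.rescale Est (fun S => p S + s * (q S - p S)) = fun S =>
      I.rescale Est p S + s * (I.rescale Est q S - I.rescale Est p S) := by
  funext S; simp only [rescale]; ring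

theorem weightSet_segment (I : SetCoverInstance m n) {Est : ℝ} {p q : Fin m → ℝ} {s : ℝ}
    (hp : p ∈ I.weightSet Est) (hq : q ∈ I.weightSet Est) (hs0 : 0 ≤ s) (hs1 : s ≤ 1) :
    (fun S => p S + s * (q S - p S)) ∈ I.weightSet Est := by
  refine ⟨fun S => ?_, ?_⟩
  · have h1 := hp.1 S
    have h2 := hq.1 S
    constructor <;> nlinarith
  · have h : ∑ S, I.cost S * (p S + s * (q S - p S)) =
        (1 - s) * ∑ S, I.cost S * p S + s * ∑ S, I.cost S * q S := by
      simp only [Finset.mul_sum, ← Finset.sum_add_distrib]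
      exact Finset.sum_congr rfl fun S _ => by ring
    rw [h]
    nlinarith [hp.2, hq.2]

theorem rescale_nonneg (I : SetCoverInstance m n) {Est : ℝ} (hEst : 0 < Est) {p : Fin m → ℝ}
    (hp : p ∈ I.weightSet Est) (S : Fin m) : 0 ≤ I.rescale Est p S :=
  div_nonneg (mul_nonneg (I.cost_pos S).le (hp.1 S).1) hEst.le

theorem rescale_pos (I : SetCoverInstance m n) {Est : ℝ} (hEst : 0 < Est) {p : Fin m → ℝ}
    (hp : ∀ S, 0 < p S) (S : Fin m) : 0 < I.rescale Est p S :=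
  div_pos (mul_pos (I.cost_pos S) (hp S)) hEst

/-- The first order condition of a mirror step, evaluated at a point of the segment to `q`. -/
theorem IsMirrorStep.segment_le {I : SetCoverInstance m n} {Est η : ℝ} {z g p q : Fin m → ℝ}
    (h : I.IsMirrorStep Est η z g p) (hEst : 0 < Est) (hη : 0 < η) (hz : ∀ S, 0 < z S)
    (hq : q ∈ I.weightSet Est) {s : ℝ} (hs0 : 0 < s) (hs1 : s ≤ 1)
    (hpos : ∀ S, 0 < I.rescale Est p S + s * (I.rescale Est q S - I.rescale Est p S)) :
    η * ∑ S, g S * (q S - p S) ≤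
      ∑ S, Real.log ((I.rescale Est p S + s * (I.rescale Est q S - I.rescale Est p S)) / z S) *
        (I.rescale Est q S - I.rescale Est p S) := by
  have hmin : I.mirrorObjective Est η z g p ≤ _ :=
    h.2 (I.weightSet_segment h.1 hq hs0.le hs1)
  have hseg := uKL_segment_sub_le (I.rescale_nonneg hEst h.1) hz hpos
  simp only [mirrorObjective, rescale_segment] at hmin
  have hlin : ∑ S, g S * (p S + s * (q S - p S)) =
      ∑ S, g S * p S + s * ∑ S, g S * (q S - p S) := by
    simp only [Finset.mul_sum, ← Finset.sum_add_distrib]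
    exact Finset.sum_congr rfl fun S _ => by ring
  rw [hlin] at hmin
  set A := uKL (fun S => I.rescale Est p S + s * (I.rescale Est q S - I.rescale Est p S)) z
  set B := uKL (I.rescale Est p) z
  have h1 : s * ∑ S, g S * (q S - p S) ≤ 1 / η * (A - B) := by linarith
  have h2 : η * (s * ∑ S, g S * (q S - p S)) ≤ A - B := by
    calc _ ≤ η * (1 / η * (A - B)) := mul_le_mul_of_nonneg_left h1 hη.le
      _ = A - B := by field_simp
  refine le_of_mul_le_mul_left (?_ : s * _ ≤ s * _) hs0
  linarith

theorem exists_pos_mem_weightSet (I : SetCoverInstance m n) {Est : ℝ} (hEst : 0 < Est) :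
    ∃ q ∈ I.weightSet Est, ∀ S, 0 < q S := by
  have hc : 0 ≤ ∑ S, I.cost S := Finset.sum_nonneg fun S _ => (I.cost_pos S).le
  -- A constant vector, small enough for both the box and the cost constraint.
  refine ⟨fun _ => Est / (Est + ∑ S, I.cost S), ⟨fun S => ⟨by positivity, ?_⟩, ?_⟩,
    fun S => by positivity⟩
  · rw [div_le_one (by positivity)]
    linarith
  · rw [← Finset.sum_mul, mul_div_assoc', div_le_iff₀ (by positivity)]
    nlinarith

/-- The entropy has slope −∞ at 0, so at a point with a zero coordinate a small move towards a
strictly positive admissible point would lower the objective. Positivity makes the iterate a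
legitimate centre for the next step. -/
theorem IsMirrorStep.pos {I : SetCoverInstance m n} {Est η : ℝ} {z g p : Fin m → ℝ}
    (h : I.IsMirrorStep Est η z g p) (hEst : 0 < Est) (hη : 0 < η) (hz : ∀ S, 0 < z S)
    (S : Fin m) : 0 < p S := by
  by_contra hS
  have hpS : p S = 0 := le_antisymm (not_lt.1 hS) (h.1.1 S).1
  obtain ⟨q, hq, hqpos⟩ := I.exists_pos_mem_weightSet hEst
  have hx := I.rescale_nonneg hEst h.1
  have hy := I.rescale_pos hEst hqpos
  have hxS : I.rescale Est p S = 0 := by simp [rescale, hpS]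
  set x := I.rescale Est p
  set y := I.rescale Est q
  -- In coordinate `S` the moved point is `s * y S`, which contributes log s. In every other
  -- coordinate it lies between `x R` and `y R`, so replacing it by `y R` in the logarithm only
  -- increases the term, whatever the sign of `y R - x R`. The resulting bound is uniform in `s`.
  have key : ∀ s : ℝ, 0 < s → s ≤ 1 → η * ∑ S, g S * (q S - p S) ≤
      Real.log s * y S + ∑ R, Real.log (y R / z R) * (y R - x R) := by
    intro s hs0 hs1
    have hpos : ∀ R, 0 < x R + s * (y R - x R) := fun R => by
      nlinarith [mul_pos hs0 (hy R), mul_nonneg (sub_nonneg.2 hs1) (hx R)]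
    refine (h.segment_le hEst hη hz hq hs0 hs1 hpos).trans ?_
    have hsum : Real.log s * y S = ∑ R, if R = S then Real.log s * y S else 0 := by simp
    rw [hsum, ← Finset.sum_add_distrib]
    refine Finset.sum_le_sum fun R _ => ?_
    have hyz : 0 < y R / z R := div_pos (hy R) (hz R)
    have hpz : 0 < (x R + s * (y R - x R)) / z R := div_pos (hpos R) (hz R)
    by_cases hR : R = S
    · subst hR
      rw [if_pos rfl]
      change Real.log ((x R + s * (y R - x R)) / z R) * (y R - x R) ≤ _
      rw [hxS, zero_add, sub_zero, mul_div_assoc, Real.log_mul hs0.ne' hyz.ne']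
      linarith
    · rw [if_neg hR, zero_add]
      change Real.log ((x R + s * (y R - x R)) / z R) * (y R - x R) ≤ _
      rcases le_total (x R) (y R) with hle | hle
      · refine mul_le_mul_of_nonneg_right (Real.log_le_log hpz ?_) (sub_nonneg.2 hle)
        refine div_le_div_of_nonneg_right ?_ (hz R).le
        nlinarith
      · refine mul_le_mul_of_nonpos_right (Real.log_le_log hyz ?_) (sub_nonpos.2 hle)
        refine div_le_div_of_nonneg_right ?_ (hz R).le
        nlinarith
  set C := ∑ R, Real.log (y R / z R) * (y R - x R)
  set B := η * ∑ S, g S * (q S - p S)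
  have hyS := hy S
  -- This `s` makes the first term equal to −(|C − B| + 1), which contradicts `key`.
  have hk := key (Real.exp (-(|C - B| + 1) / y S)) (Real.exp_pos _)
    (Real.exp_le_one_iff.2 (div_nonpos_of_nonpos_of_nonneg
      (by linarith [abs_nonneg (C - B)]) hyS.le))
  rw [Real.log_exp, div_mul_cancel₀ _ hyS.ne'] at hk
  linarith [le_abs_self (C - B)]

/-- Let s tend to 0 from the right in the segment inequality, where positivity of `p` makes the
logarithms continuous, and rewrite the limit by the three-point identity. -/
theorem IsMirrorStep.first_order {I : SetCoverInstance m n} {Est η : ℝ} {z g p q : Fin m → ℝ}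
    (h : I.IsMirrorStep Est η z g p) (hEst : 0 < Est) (hη : 0 < η) (hz : ∀ S, 0 < z S)
    (hq : q ∈ I.weightSet Est) :
    η * ∑ S, g S * (q S - p S) ≤
      uKL (I.rescale Est q) z - uKL (I.rescale Est p) z -
        uKL (I.rescale Est q) (I.rescale Est p) := by
  have hx := I.rescale_pos hEst (h.pos hEst hη hz)
  have hy := I.rescale_nonneg hEst hq
  rw [← uKL_three_point hx hz]
  set x := I.rescale Est p with hxdef
  set y := I.rescale Est q with hydef
  have hcont : ContinuousAt (fun s : ℝ =>
      ∑ S, Real.log ((x S + s * (y S - x S)) / z S) * (y S - x S)) 0 := by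
    refine tendsto_finsetSum _ fun S _ => ?_
    refine ContinuousAt.mul (ContinuousAt.log (by fun_prop) ?_) continuousAt_const
    simpa using ⟨(hx S).ne', (hz S).ne'⟩
  have hlim := hcont.tendsto.mono_left (nhdsWithin_le_nhds (s := Set.Ioi 0))
  simp only [zero_mul, add_zero] at hlim
  refine ge_of_tendsto hlim ?_
  filter_upwards [Ioo_mem_nhdsGT (zero_lt_one (α := ℝ))] with s hs
  refine h.segment_le hEst hη hz hq hs.1 hs.2.le fun S => ?_
  change 0 < x S + s * (y S - x S)
  nlinarith [mul_pos (sub_pos.2 hs.2) (hx S), mul_nonneg hs.1.le (hy S)]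

/-- The regret inequality of one mirror step with a rescaled gradient `w` in `[0,1]`. -/
theorem IsMirrorStep.regret {I : SetCoverInstance m n} {Est η : ℝ} {z g p q : Fin m → ℝ}
    (h : I.IsMirrorStep Est η (I.rescale Est z) g p) (hEst : 0 < Est) (hη : 0 < η) (hη1 : η ≤ 1)
    (hz : ∀ S, 0 < z S) (hq : q ∈ I.weightSet Est) (hg0 : ∀ S, 0 ≤ g S)
    (hg1 : ∀ S, g S * Est ≤ I.cost S) :
    ∑ S, g S * q S ≤ 1 / η * (uKL (I.rescale Est q) (I.rescale Est z) -
      uKL (I.rescale Est q) (I.rescale Est p)) + (1 + η) * ∑ S, g S * z S := by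
  have hfo := h.first_order hEst hη (I.rescale_pos hEst hz) hq
  have hx := I.rescale_nonneg hEst h.1
  have hzr := I.rescale_pos hEst hz
  -- Here the movement from `z` to `p` is paid for. Nonnegativity of the divergence of x from the
  -- tilted point y·exp(ηw) gives ηwx − y(exp(ηw) − 1) as a lower bound for the divergence of x from
  -- y. Then exp u ≤ 1 + u + u² for 0 ≤ u ≤ 1, and w² ≤ w on [0,1] makes the second-order term a
  -- multiple of the gain itself.
  have hlow : η * ∑ S, g S * p S - η * (1 + η) * ∑ S, g S * z S ≤
      uKL (I.rescale Est p) (I.rescale Est z) := by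
    simp only [uKL, Finset.mul_sum, ← Finset.sum_sub_distrib]
    refine Finset.sum_le_sum fun S _ => ?_
    set x := I.rescale Est p S with hxS
    set y := I.rescale Est z S with hyS
    set w := g S * Est / I.cost S with hw
    have hc := I.cost_pos S
    have hw0 : 0 ≤ w := div_nonneg (mul_nonneg (hg0 S) hEst.le) hc.le
    have hw1 : w ≤ 1 := (div_le_one hc).2 (hg1 S)
    have e1 : g S * p S = w * x := by rw [hxS, hw, rescale]; field_simp
    have e2 : g S * z S = w * y := by rw [hyS, hw, rescale]; field_simp
    have hy := hzr S
    have hexp : Real.exp (η * w) ≤ 1 + η * w + (η * w) ^ 2 := by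
      have hηw : |η * w| ≤ 1 := by
        rw [abs_of_nonneg (by positivity)]
        nlinarith
      have := (abs_le.1 (Real.abs_exp_sub_one_sub_id_le hηw)).2
      linarith
    have hnn := mul_log_div_sub_add_nonneg (hx S) (mul_pos hy (Real.exp_pos (η * w)))
    have hsplit := mul_log_div_split (a := x) (mul_pos hy (Real.exp_pos (η * w))) hy
    rw [mul_div_cancel_left₀ _ hy.ne', Real.log_exp] at hsplit
    have hyexp := mul_le_mul_of_nonneg_left hexp hy.le
    have hsq : (η * w) ^ 2 ≤ η ^ 2 * w := by nlinarith [sq_nonneg η, mul_nonneg hw0 (sub_nonneg.2 hw1)]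
    have hysq := mul_le_mul_of_nonneg_left hsq hy.le
    rw [e1, e2, hsplit]
    linarith
  have hsum : ∑ S, g S * (q S - p S) = ∑ S, g S * q S - ∑ S, g S * p S := by
    rw [← Finset.sum_sub_distrib]
    exact Finset.sum_congr rfl fun S _ => by ring
  rw [hsum] at hfo
  have hfin : η * ∑ S, g S * q S ≤ η * (1 / η * (uKL (I.rescale Est q) (I.rescale Est z) -
      uKL (I.rescale Est q) (I.rescale Est p)) + (1 + η) * ∑ S, g S * z S) := by
    have e : η * (1 / η * (uKL (I.rescale Est q) (I.rescale Est z) -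
      uKL (I.rescale Est q) (I.rescale Est p)) + (1 + η) * ∑ S, g S * z S) =
      (uKL (I.rescale Est q) (I.rescale Est z) -
      uKL (I.rescale Est q) (I.rescale Est p)) + η * (1 + η) * ∑ S, g S * z S := by
      field_simp
    rw [e]
    linarith
  exact le_of_mul_le_mul_left hfin hη

theorem isMirrorStep_mirrorStep (I : SetCoverInstance m n) {Est : ℝ} (hEst : 0 ≤ Est) (η : ℝ)
    (z g : Fin m → ℝ) : I.IsMirrorStep Est η z g (I.mirrorStep Est η z g) :=
  Classical.epsilon_spec (I.exists_isMirrorStep hEst η z g)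

theorem mem_containing {I : SetCoverInstance m n} {e : Fin n} {S : Fin m} :
    S ∈ I.containing e ↔ e ∈ I.sets S := by
  simp [containing]

/-! ### The offline optimum and residual costs -/

section Optimum

theorem exists_isCover_costOf_eq_opt (I : SetCoverInstance m n) :
    ∃ F, I.IsCover F ∧ I.costOf F = I.opt := by
  have hne : {x | ∃ F : Finset (Fin m), I.IsCover F ∧ I.costOf F = x}.Nonempty :=
    ⟨_, Finset.univ, fun e => by
      obtain ⟨S, hS⟩ := I.coverable e
      exact ⟨S, Finset.mem_univ S, hS⟩, rfl⟩
  have hfin : {x | ∃ F : Finset (Fin m), I.IsCover F ∧ I.costOf F = x}.Finite :=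
    (Set.finite_range I.costOf).subset (by rintro x ⟨F, -, rfl⟩; exact ⟨F, rfl⟩)
  exact hne.csInf_mem hfin

theorem kappa_le (I : SetCoverInstance m n) {e : Fin n} {S : Fin m} (h : e ∈ I.sets S) :
    I.kappa e ≤ I.cost S :=
  Finset.inf'_le _ (mem_containing.2 h)

theorem kappa_pos (I : SetCoverInstance m n) (e : Fin n) : 0 < I.kappa e :=
  (Finset.lt_inf'_iff _).2 fun S _ => I.cost_pos S

theorem kappa_le_opt (I : SetCoverInstance m n) (e : Fin n) : I.kappa e ≤ I.opt := by
  obtain ⟨F, hF, hopt⟩ := I.exists_isCover_costOf_eq_opt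
  obtain ⟨S, hS, he⟩ := hF e
  rw [← hopt]
  exact (I.kappa_le he).trans
    (Finset.single_le_sum (f := I.cost) (fun R _ => (I.cost_pos R).le) hS)

theorem residual_nonneg (I : SetCoverInstance m n) (F : Finset (Fin m)) (e : Fin n) :
    0 ≤ I.residual F e := by
  unfold residual
  split_ifs
  exacts [le_rfl, (I.kappa_pos e).le]

theorem residual_le_kappa (I : SetCoverInstance m n) (F : Finset (Fin m)) (e : Fin n) :
    I.residual F e ≤ I.kappa e := by
  unfold residual
  split_ifs
  exacts [(I.kappa_pos e).le, le_rfl]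

theorem residual_le_opt (I : SetCoverInstance m n) (F : Finset (Fin m)) (e : Fin n) :
    I.residual F e ≤ I.opt :=
  (I.residual_le_kappa F e).trans (I.kappa_le_opt e)

theorem Covered.mono {I : SetCoverInstance m n} {F G : Finset (Fin m)} {e : Fin n}
    (h : I.Covered F e) (hFG : F ⊆ G) : I.Covered G e := by
  obtain ⟨S, hS, he⟩ := h
  exact ⟨S, hFG hS, he⟩

theorem residual_anti (I : SetCoverInstance m n) {F G : Finset (Fin m)} (hFG : F ⊆ G)
    (e : Fin n) : I.residual G e ≤ I.residual F e := by
  by_cases h : I.Covered F e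
  · simp [residual, h, h.mono hFG]
  · rw [show I.residual F e = I.kappa e by simp [residual, h]]
    exact I.residual_le_kappa G e

theorem costOf_nonneg (I : SetCoverInstance m n) (F : Finset (Fin m)) : 0 ≤ I.costOf F :=
  Finset.sum_nonneg fun S _ => (I.cost_pos S).le

theorem costOf_union_le (I : SetCoverInstance m n) (F G : Finset (Fin m)) :
    I.costOf (F ∪ G) ≤ I.costOf F + I.costOf G := by
  have h := Finset.sum_union_inter (s₁ := F) (s₂ := G) (f := I.cost)
  have h2 := I.costOf_nonneg (F ∩ G)
  unfold costOf at *
  linarith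

/-- The indicator vector of a collection of sets. -/
def indicator (F : Finset (Fin m)) (S : Fin m) : ℝ := if S ∈ F then 1 else 0

theorem indicator_mem_weightSet (I : SetCoverInstance m n) {Est : ℝ} {F : Finset (Fin m)}
    (h : I.costOf F ≤ Est) : indicator F ∈ I.weightSet Est := by
  refine ⟨fun S => ?_, ?_⟩
  · unfold indicator
    split_ifs <;> norm_num
  · simpa [indicator, costOf] using h

theorem one_le_sum_indicator {I : SetCoverInstance m n} {F : Finset (Fin m)} {e : Fin n}
    (h : I.Covered F e) : 1 ≤ ∑ S ∈ I.containing e, indicator F S := by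
  obtain ⟨S, hS, he⟩ := h
  have h1 : indicator F S = 1 := if_pos hS
  rw [← h1]
  refine Finset.single_le_sum (f := indicator F) (fun R _ => ?_) (mem_containing.2 he)
  unfold indicator
  split_ifs <;> norm_num

end Optimum

/-! ### Supergradients of the truncated gain -/

section Supergradient

variable {I : SetCoverInstance m n} {Est k : ℝ} {e : Fin n} {p g : Fin m → ℝ}

theorem sum_containing_update (I : SetCoverInstance m n) (e : Fin n) (p : Fin m → ℝ) (S : Fin m)
    (d : ℝ) : ∑ R ∈ I.containing e, (p R + if R = S then d else 0) =
      ∑ R ∈ I.containing e, p R + if e ∈ I.sets S then d else 0 := by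
  rw [Finset.sum_add_distrib, Finset.sum_ite_eq' (I.containing e) S (fun _ => d)]
  simp only [mem_containing]

theorem supergradient_coord (h : g ∈ supergradients (I.gain Est k e) p) (S : Fin m) (d : ℝ) :
    k / Est * min 1 (∑ R ∈ I.containing e, p R + if e ∈ I.sets S then d else 0) ≤
      k / Est * min 1 (∑ R ∈ I.containing e, p R) + g S * d := by
  have := h fun R => p R + if R = S then d else 0
  simpa [gain, sum_containing_update] using this

/-- Raising one coordinate by 1 cannot lower the gain. -/
theorem supergradient_nonneg (hk : 0 ≤ k / Est) (h : g ∈ supergradients (I.gain Est k e) p)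
    (S : Fin m) : 0 ≤ g S := by
  have h1 := supergradient_coord h S 1
  have h2 : min 1 (∑ R ∈ I.containing e, p R) ≤
      min 1 (∑ R ∈ I.containing e, p R + if e ∈ I.sets S then 1 else 0) := by
    refine min_le_min_left _ ?_
    split_ifs <;> linarith
  have := mul_le_mul_of_nonneg_left h2 hk
  linarith

/-- Lowering one coordinate by 1 costs at most k/Est of gain, and nothing if the set misses `e`. -/
theorem supergradient_le (hk : 0 ≤ k / Est) (h : g ∈ supergradients (I.gain Est k e) p)
    (S : Fin m) : g S ≤ if e ∈ I.sets S then k / Est else 0 := by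
  have h1 := supergradient_coord h S (-1)
  split_ifs at h1 ⊢
  · set P := ∑ R ∈ I.containing e, p R
    have h2 : min 1 P ≤ min 1 (P + -1) + 1 := by
      rw [← min_add_add_right]
      exact min_le_min (by norm_num) (by linarith)
    have := mul_le_mul_of_nonneg_left h2 hk
    linarith
  · simp at h1
    linarith

/-- The supergradient inequality at the origin, where the gain vanishes. -/
theorem sum_supergradient_mul_le (h : g ∈ supergradients (I.gain Est k e) p) :
    ∑ S, g S * p S ≤ k / Est * min 1 (∑ S ∈ I.containing e, p S) := by
  have := h 0
  simp [gain] at this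
  simpa using this

end Supergradient

/-! ### Independent sampling of sets -/

section Sampling

/-- The probability that independent sampling with probabilities `q` yields `A`. -/
def sampleWeight (q : Fin m → ℝ) (A : Finset (Fin m)) : ℝ := (∏ S ∈ A, q S) * ∏ S ∈ Aᶜ, (1 - q S)

variable {q : Fin m → ℝ}

theorem sampleWeight_nonneg (h0 : ∀ S, 0 ≤ q S) (h1 : ∀ S, q S ≤ 1) (A : Finset (Fin m)) :
    0 ≤ sampleWeight q A :=
  mul_nonneg (Finset.prod_nonneg fun S _ => h0 S)
    (Finset.prod_nonneg fun S _ => sub_nonneg.2 (h1 S))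

theorem sampleSets_apply (h0 : ∀ S, 0 ≤ q S) (h1 : ∀ S, q S ≤ 1) (A : Finset (Fin m)) :
    sampleSets q A = ENNReal.ofReal (sampleWeight q A) := by
  have hmin : ∀ S, min 1 (ENNReal.ofReal (q S)) = ENNReal.ofReal (q S) := fun S =>
    min_eq_right (by simpa using h1 S)
  have hsub : ∀ S, 1 - ENNReal.ofReal (q S) = ENNReal.ofReal (1 - q S) := fun S => by
    rw [ENNReal.ofReal_sub _ (h0 S), ENNReal.ofReal_one]
  simp only [sampleSets, PMF.ofFintype_apply, hmin, hsub, sampleWeight]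
  rw [ENNReal.ofReal_mul (Finset.prod_nonneg fun S _ => h0 S),
    ENNReal.ofReal_prod_of_nonneg fun S _ => h0 S,
    ENNReal.ofReal_prod_of_nonneg fun S _ => sub_nonneg.2 (h1 S)]

/-- Sums over outcomes of independent choices factor over the sets. Event probabilities follow by
replacing the factors of forbidden choices by 0. -/
theorem sum_prod_mul_prod_compl (a b : Fin m → ℝ) :
    ∑ A : Finset (Fin m), (∏ S ∈ A, a S) * ∏ S ∈ Aᶜ, b S = ∏ S, (a S + b S) := by
  rw [Finset.prod_add, Finset.powerset_univ]
  simp only [Finset.compl_eq_univ_sdiff]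

theorem sum_sampleWeight (q : Fin m → ℝ) : ∑ A, sampleWeight q A = 1 := by
  simp only [sampleWeight]
  rw [sum_prod_mul_prod_compl]
  simp

theorem sum_sampleWeight_mem (q : Fin m → ℝ) (S : Fin m) :
    ∑ A, (if S ∈ A then sampleWeight q A else 0) = q S := by
  have h : ∀ A : Finset (Fin m), (if S ∈ A then sampleWeight q A else 0) =
      (∏ R ∈ A, q R) * ∏ R ∈ Aᶜ, (if R = S then 0 else 1 - q R) := by
    intro A
    split_ifs with hS
    · refine congrArg _ (Finset.prod_congr rfl fun R hR => ?_)
      rw [if_neg]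
      rintro rfl
      exact Finset.mem_compl.1 hR hS
    · have hz : ∏ R ∈ Aᶜ, (if R = S then 0 else 1 - q R) = 0 :=
        Finset.prod_eq_zero (Finset.mem_compl.2 hS) (if_pos rfl)
      rw [hz, mul_zero]
  simp only [h]
  rw [sum_prod_mul_prod_compl, Finset.prod_eq_single S]
  · simp
  · intro R _ hR
    simp [hR]
  · simp

theorem sum_sampleWeight_disjoint (q : Fin m → ℝ) (B : Finset (Fin m)) :
    ∑ A, (if Disjoint A B then sampleWeight q A else 0) = ∏ S ∈ B, (1 - q S) := by
  have h : ∀ A : Finset (Fin m), (if Disjoint A B then sampleWeight q A else 0) =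
      (∏ R ∈ A, if R ∈ B then 0 else q R) * ∏ R ∈ Aᶜ, (1 - q R) := by
    intro A
    split_ifs with hA
    · refine congrArg (· * _) (Finset.prod_congr rfl fun R hR => ?_)
      rw [if_neg (Finset.disjoint_left.1 hA hR)]
    · obtain ⟨R, hRA, hRB⟩ := Finset.not_disjoint_iff.1 hA
      have hz : ∏ R ∈ A, (if R ∈ B then 0 else q R) = 0 :=
        Finset.prod_eq_zero hRA (if_pos hRB)
      rw [hz, zero_mul]
  simp only [h]
  rw [sum_prod_mul_prod_compl, ← Finset.prod_subset (Finset.subset_univ B)]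
  · exact Finset.prod_congr rfl fun S hS => by simp [hS]
  · intro S _ hS
    simp [hS]

theorem sum_sampleWeight_costOf (I : SetCoverInstance m n) (q : Fin m → ℝ) :
    ∑ A, sampleWeight q A * I.costOf A = ∑ S, I.cost S * q S := by
  have h : ∀ A : Finset (Fin m), sampleWeight q A * I.costOf A =
      ∑ S, I.cost S * (if S ∈ A then sampleWeight q A else 0) := by
    intro A
    simp only [costOf, Finset.mul_sum, mul_ite, mul_zero, Finset.sum_ite_mem, Finset.univ_inter]
    exact Finset.sum_congr rfl fun S _ => mul_comm _ _
  simp only [h]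
  rw [Finset.sum_comm]
  simp only [← Finset.mul_sum, sum_sampleWeight_mem]

/-- Chain 1 − q ≤ exp(−q) with exp(−y) ≤ 1/(1 + y) ≤ 1 − y/2 on [0,1]. With q the sampling
probabilities and B the sets containing an element, the product is the chance that the sample misses
that element. -/
theorem prod_one_sub_le {y : ℝ} (B : Finset (Fin m)) (h1 : ∀ S, q S ≤ 1) (hy0 : 0 ≤ y)
    (hy1 : y ≤ 1) (hy : y ≤ ∑ S ∈ B, q S) : ∏ S ∈ B, (1 - q S) ≤ 1 - y / 2 := by
  calc ∏ S ∈ B, (1 - q S) ≤ ∏ S ∈ B, Real.exp (-q S) :=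
        Finset.prod_le_prod (fun S _ => sub_nonneg.2 (h1 S))
          fun S _ => by linarith [Real.add_one_le_exp (-q S)]
    _ = Real.exp (-∑ S ∈ B, q S) := by rw [← Real.exp_sum, Finset.sum_neg_distrib]
    _ ≤ Real.exp (-y) := Real.exp_le_exp.2 (neg_le_neg hy)
    _ ≤ 1 - y / 2 := by
      rw [Real.exp_neg]
      refine (inv_anti₀ (by linarith) (Real.add_one_le_exp y)).trans ?_
      rw [inv_le_iff_one_le_mul₀ (by linarith)]
      nlinarith

end Sampling

/-! ### Invariants and the potential -/

/-- The properties that every reachable state has. -/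
structure Inv (I : SetCoverInstance m n) (Est : ℝ) (σ : State m n) : Prop where
  weights_mem : σ.weights ∈ I.weightSet Est
  weights_pos : ∀ S, 0 < σ.weights S
  covered : ∀ e, e ∉ σ.unseen → I.Covered σ.bought e
  cost_le : I.costOf σ.bought ≤ σ.paid

theorem Inv.init (I : SetCoverInstance m n) {Est η : ℝ} (hEst : 0 < Est) (hη : 0 < η) (hm : 0 < m) :
    I.Inv Est (I.init Est η) := by
  have h := I.isMirrorStep_mirrorStep hEst.le η (fun _ => 1 / (m : ℝ)) 0
  exact ⟨h.1, h.pos hEst hη fun _ => by positivity, fun e he => absurd (Finset.mem_univ e) he,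
    by simp [SetCoverInstance.init, costOf]⟩

theorem Inv.nextState {I : SetCoverInstance m n} {Est η : ℝ} {σ : State m n}
    (h : I.Inv Est σ) (hEst : 0 < Est) (hη : 0 < η) (T : I.TieBreaking Est) (e : Fin n)
    (A : Finset (Fin m)) : I.Inv Est (I.nextState Est η T σ e A) := by
  have hs := I.isMirrorStep_mirrorStep hEst.le η (I.rescale Est σ.weights) (T.grad σ e)
  refine ⟨hs.1, hs.pos hEst hη (I.rescale_pos hEst h.weights_pos), fun f hf => ?_, ?_⟩
  · simp only [SetCoverInstance.nextState, Finset.mem_erase, not_and] at hf ⊢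
    by_cases hfe : f = e
    · subst hfe
      by_cases hc : I.Covered σ.bought f
      · exact hc.mono (Finset.subset_union_left.trans Finset.subset_union_left)
      · exact ⟨T.backup σ f, by simp [hc], T.backup_mem σ f⟩
    · exact (h.covered f (hf hfe)).mono (Finset.subset_union_left.trans Finset.subset_union_left)
  · simp only [SetCoverInstance.nextState]
    refine (I.costOf_union_le _ _).trans (add_le_add_left ?_ _)
    refine (I.costOf_union_le _ _).trans (add_le_add h.cost_le ?_)
    by_cases hc : I.Covered σ.bought e
    · simp [hc, residual, costOf]
    · simp [hc, residual, costOf, T.backup_cost]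

/-- The total residual cost of the elements that have not arrived yet. -/
noncomputable def uncoveredCost (I : SetCoverInstance m n) (σ : State m n) : ℝ :=
  ∑ f ∈ σ.unseen, I.residual σ.bought f

theorem uncoveredCost_nonneg (I : SetCoverInstance m n) (σ : State m n) : 0 ≤ I.uncoveredCost σ :=
  Finset.sum_nonneg fun f _ => I.residual_nonneg _ f

/-- The potential of a state relative to an optimal cover `F`: the divergence of the weights from
the indicator of `F`, the logarithm of the uncovered cost, and a harmonic number. -/
noncomputable def potential (I : SetCoverInstance m n) (Est η : ℝ) (F : Finset (Fin m))
    (σ : State m n) : ℝ :=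
  1 / η * uKL (I.rescale Est (indicator F)) (I.rescale Est σ.weights) +
    2 * (2 * Real.log (1 + I.uncoveredCost σ / Est) + (harmonic σ.unseen.card : ℝ))

theorem Inv.potential_nonneg {I : SetCoverInstance m n} {Est η : ℝ} {F : Finset (Fin m)}
    {σ : State m n} (h : I.Inv Est σ) (hEst : 0 < Est) (hη : 0 < η) (hF : I.costOf F ≤ Est) :
    0 ≤ I.potential Est η F σ := by
  have h1 := uKL_nonneg (I.rescale_nonneg hEst (I.indicator_mem_weightSet hF))
    (I.rescale_pos hEst h.weights_pos)
  have h2 : 0 ≤ Real.log (1 + I.uncoveredCost σ / Est) :=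
    Real.log_nonneg (by linarith [div_nonneg (I.uncoveredCost_nonneg σ) hEst.le])
  have h3 : (0 : ℝ) ≤ (harmonic σ.unseen.card : ℝ) := by
    rw [harmonic]
    positivity
  unfold potential
  positivity

/-! ### Estimates for one arrival -/

section Step

variable {I : SetCoverInstance m n} {Est η : ℝ} {σ : State m n}

/-- The sampling probabilities after the arrival of `e`. -/
noncomputable def sampleProb (I : SetCoverInstance m n) (Est : ℝ) (σ : State m n) (e : Fin n)
    (S : Fin m) : ℝ :=
  I.residual σ.bought e / Est * σ.weights S

theorem residual_div_nonneg (hEst : 0 < Est) (e : Fin n) : 0 ≤ I.residual σ.bought e / Est :=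
  div_nonneg (I.residual_nonneg _ e) hEst.le

theorem residual_div_le_one (hEst : 0 < Est) (hopt : I.opt ≤ Est) (e : Fin n) :
    I.residual σ.bought e / Est ≤ 1 :=
  (div_le_one hEst).2 ((I.residual_le_opt _ e).trans hopt)

theorem Inv.sampleProb_nonneg (h : I.Inv Est σ) (hEst : 0 < Est) (e : Fin n) (S : Fin m) :
    0 ≤ I.sampleProb Est σ e S :=
  mul_nonneg (residual_div_nonneg hEst e) (h.weights_mem.1 S).1

theorem Inv.sampleProb_le_one (h : I.Inv Est σ) (hEst : 0 < Est) (hopt : I.opt ≤ Est) (e : Fin n)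
    (S : Fin m) : I.sampleProb Est σ e S ≤ 1 :=
  mul_le_one₀ (residual_div_le_one hEst hopt e) (h.weights_mem.1 S).1 (h.weights_mem.1 S).2

/-- The backup costs the residual κ, and the samples cost (κ/Est)⟨c, p⟩ ≤ κ in expectation. -/
theorem Inv.sum_paid_nextState_le (h : I.Inv Est σ) (hEst : 0 < Est) (T : I.TieBreaking Est)
    (e : Fin n) :
    ∑ A, sampleWeight (I.sampleProb Est σ e) A * (I.nextState Est η T σ e A).paid ≤
      σ.paid + 2 * I.residual σ.bought e := by
  simp only [SetCoverInstance.nextState, mul_add, Finset.sum_add_distrib, ← Finset.sum_mul,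
    sum_sampleWeight, one_mul, sum_sampleWeight_costOf]
  have hc : ∑ S, I.cost S * I.sampleProb Est σ e S =
      I.residual σ.bought e / Est * ∑ S, I.cost S * σ.weights S := by
    rw [Finset.mul_sum]
    exact Finset.sum_congr rfl fun S _ => by rw [sampleProb]; ring
  have h2 := mul_le_mul_of_nonneg_left h.weights_mem.2
    (residual_div_nonneg (I := I) (σ := σ) hEst e)
  rw [div_mul_cancel₀ _ hEst.ne'] at h2
  linarith

/-- The total gain of the elements that have not arrived yet at the current weights. -/
noncomputable def fractionalCoverage (I : SetCoverInstance m n) (Est : ℝ) (σ : State m n) : ℝ :=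
  ∑ f ∈ σ.unseen, I.gain Est (I.residual σ.bought f) f σ.weights

/-- Coverage by the backup set and the departure of `e` are given away. What remains depends on the
sample only through which elements it misses. -/
theorem uncoveredCost_nextState_le (T : I.TieBreaking Est) (e : Fin n) (A : Finset (Fin m)) :
    I.uncoveredCost (I.nextState Est η T σ e A) ≤
      ∑ f ∈ σ.unseen, if Disjoint A (I.containing f) then I.residual σ.bought f else 0 := by
  have hnn : ∀ f, 0 ≤ I.residual (I.nextState Est η T σ e A).bought f := fun f =>
    I.residual_nonneg _ f
  refine (Finset.sum_le_sum_of_subset_of_nonneg (Finset.erase_subset e σ.unseen)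
    fun f _ _ => hnn f).trans (Finset.sum_le_sum fun f _ => ?_)
  split_ifs with hd
  · exact I.residual_anti (Finset.subset_union_left.trans Finset.subset_union_left) f
  · obtain ⟨S, hSA, hSf⟩ := Finset.not_disjoint_iff.1 hd
    refine le_of_eq (if_pos ⟨S, ?_, mem_containing.1 hSf⟩)
    exact Finset.mem_union_right _ hSA

/-- Each unseen `f` is hit by the sample with probability at least half of κ/Est · min(1, P), where
P is the weight of the sets containing `f`. The bound is a product of a factor in `e` and a sum over
`f`, which is what allows averaging over `e` later. -/
theorem Inv.sum_uncoveredCost_nextState_le (h : I.Inv Est σ) (hEst : 0 < Est)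
    (hopt : I.opt ≤ Est) (T : I.TieBreaking Est) (e : Fin n) :
    ∑ A, sampleWeight (I.sampleProb Est σ e) A * I.uncoveredCost (I.nextState Est η T σ e A) ≤
      I.uncoveredCost σ - I.residual σ.bought e / 2 * I.fractionalCoverage Est σ := by
  have hw := sampleWeight_nonneg (h.sampleProb_nonneg hEst e) (h.sampleProb_le_one hEst hopt e)
  calc _ ≤ ∑ A, sampleWeight (I.sampleProb Est σ e) A *
        ∑ f ∈ σ.unseen, (if Disjoint A (I.containing f) then I.residual σ.bought f else 0) :=
      Finset.sum_le_sum fun A _ =>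
        mul_le_mul_of_nonneg_left (uncoveredCost_nextState_le T e A) (hw A)
    _ = ∑ f ∈ σ.unseen, I.residual σ.bought f *
          ∏ S ∈ I.containing f, (1 - I.sampleProb Est σ e S) := by
      simp only [Finset.mul_sum]
      rw [Finset.sum_comm]
      refine Finset.sum_congr rfl fun f _ => ?_
      rw [← sum_sampleWeight_disjoint, Finset.mul_sum]
      refine Finset.sum_congr rfl fun A _ => ?_
      split_ifs <;> ring
    _ ≤ ∑ f ∈ σ.unseen, (I.residual σ.bought f - I.residual σ.bought e / 2 *
          I.gain Est (I.residual σ.bought f) f σ.weights) := by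
      refine Finset.sum_le_sum fun f _ => ?_
      have ha0 := residual_div_nonneg (I := I) (σ := σ) hEst e
      have ha1 := residual_div_le_one (σ := σ) hEst hopt e
      set a := I.residual σ.bought e / Est with ha
      set P := ∑ S ∈ I.containing f, σ.weights S with hP
      have hP0 : 0 ≤ P := Finset.sum_nonneg fun S _ => (h.weights_mem.1 S).1
      have hmin0 : 0 ≤ min 1 P := le_min zero_le_one hP0
      have hle := prod_one_sub_le (q := I.sampleProb Est σ e) (I.containing f) (y := a * min 1 P)
        (h.sampleProb_le_one hEst hopt e) (mul_nonneg ha0 hmin0)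
        (mul_le_one₀ ha1 hmin0 (min_le_left _ _)) (by
          simp only [sampleProb, ← Finset.mul_sum]
          exact mul_le_mul_of_nonneg_left (min_le_right _ _) ha0)
      refine (mul_le_mul_of_nonneg_left hle (I.residual_nonneg σ.bought f)).trans (le_of_eq ?_)
      rw [gain, ← hP, ha]
      field_simp
    _ = _ := by
      rw [Finset.sum_sub_distrib, ← Finset.mul_sum]
      rfl

theorem fractionalCoverage_mul_le (hEst : 0 < Est) (h : I.Inv Est σ) :
    I.fractionalCoverage Est σ * Est ≤ I.uncoveredCost σ ∧ 0 ≤ I.fractionalCoverage Est σ := by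
  have hterm : ∀ f, 0 ≤ min 1 (∑ S ∈ I.containing f, σ.weights S) := fun f =>
    le_min zero_le_one (Finset.sum_nonneg fun S _ => (h.weights_mem.1 S).1)
  constructor
  · rw [fractionalCoverage, Finset.sum_mul]
    refine Finset.sum_le_sum fun f _ => ?_
    have h1 := mul_le_mul_of_nonneg_left
      (min_le_left 1 (∑ S ∈ I.containing f, σ.weights S)) (I.residual_nonneg σ.bought f)
    rw [gain]
    calc _ = I.residual σ.bought f * min 1 (∑ S ∈ I.containing f, σ.weights S) := by field_simp
      _ ≤ _ := by simpa using h1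
  · exact Finset.sum_nonneg fun f _ => mul_nonneg (residual_div_nonneg hEst f) (hterm f)

/-- Write f for the gain, g for its supergradient at the weights p, and q for the indicator of the
cover. Then κ/Est = f(q) ≤ f(p) + ⟨g, q⟩ − ⟨g, p⟩. The regret bound on ⟨g, q⟩ leaves f(p) + η⟨g, p⟩
besides the divergence drop, and this is at most 2 f(p) since ⟨g, p⟩ ≤ f(p) and η ≤ 1. -/
theorem Inv.residual_le_divergence_sub (h : I.Inv Est σ) (hEst : 0 < Est) (hη : 0 < η)
    (hη1 : η ≤ 1) (T : I.TieBreaking Est) {F : Finset (Fin m)} (hF : I.IsCover F)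
    (hFc : I.costOf F ≤ Est) (e : Fin n) (A : Finset (Fin m)) :
    I.residual σ.bought e / Est ≤
      1 / η * uKL (I.rescale Est (indicator F)) (I.rescale Est σ.weights) -
      1 / η * uKL (I.rescale Est (indicator F))
        (I.rescale Est (I.nextState Est η T σ e A).weights) +
      2 * I.gain Est (I.residual σ.bought e) e σ.weights := by
  have hs : I.IsMirrorStep Est η (I.rescale Est σ.weights) (T.grad σ e)
      (I.nextState Est η T σ e A).weights :=
    I.isMirrorStep_mirrorStep hEst.le η _ _
  have hk := residual_div_nonneg (I := I) (σ := σ) hEst e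
  have hg := T.grad_mem σ e
  have hg0 := supergradient_nonneg hk hg
  have hg1 : ∀ S, T.grad σ e S * Est ≤ I.cost S := fun S => by
    have h1 := supergradient_le hk hg S
    split_ifs at h1 with hS
    · exact ((le_div_iff₀ hEst).1 h1).trans ((I.residual_le_kappa _ e).trans (I.kappa_le hS))
    · nlinarith [I.cost_pos S, hg0 S]
  have hreg := hs.regret hEst hη hη1 h.weights_pos (I.indicator_mem_weightSet hFc) hg0 hg1
  have hgp := sum_supergradient_mul_le hg
  have hgp0 : 0 ≤ ∑ S, T.grad σ e S * σ.weights S :=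
    Finset.sum_nonneg fun S _ => mul_nonneg (hg0 S) (h.weights_mem.1 S).1
  have hind := hg (indicator F)
  rw [gain, min_eq_left (one_le_sum_indicator (hF e)), mul_one] at hind
  simp only [mul_sub, Finset.sum_sub_distrib] at hind
  rw [gain] at hind ⊢
  nlinarith

end Step

/-! ### The budget is a supermartingale -/

section Potential

variable {I : SetCoverInstance m n} {Est η : ℝ} {σ : State m n}

/-- The concave logarithm lies below its tangent at `a`. -/
theorem log_one_add_div_le {a b c : ℝ} (ha : 0 ≤ a) (hb : 0 ≤ b) (hc : 0 < c) :
    Real.log (1 + b / c) ≤ Real.log (1 + a / c) + (b - a) / (a + c) := by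
  have ha' : 0 < 1 + a / c := by positivity
  have hb' : 0 < 1 + b / c := by positivity
  have h := Real.log_le_sub_one_of_pos (div_pos hb' ha')
  rw [Real.log_div hb'.ne' ha'.ne'] at h
  have e : (1 + b / c) / (1 + a / c) - 1 = (b - a) / (a + c) := by
    field_simp
    ring
  linarith

/-- The tangent at the current uncovered cost is affine, so the bound on the expected uncovered cost
passes through the logarithm. -/
theorem Inv.sum_log_nextState_le (h : I.Inv Est σ) (hEst : 0 < Est) (hopt : I.opt ≤ Est)
    (T : I.TieBreaking Est) (e : Fin n) :
    ∑ A, sampleWeight (I.sampleProb Est σ e) A *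
      Real.log (1 + I.uncoveredCost (I.nextState Est η T σ e A) / Est) ≤
      Real.log (1 + I.uncoveredCost σ / Est) -
        I.residual σ.bought e / 2 * I.fractionalCoverage Est σ / (I.uncoveredCost σ + Est) := by
  have hw := sampleWeight_nonneg (h.sampleProb_nonneg hEst e) (h.sampleProb_le_one hEst hopt e)
  have hΦ := I.uncoveredCost_nonneg σ
  have hsum := h.sum_uncoveredCost_nextState_le (η := η) hEst hopt T e
  have hone := sum_sampleWeight (I.sampleProb Est σ e)
  set w := sampleWeight (I.sampleProb Est σ e)
  calc _ ≤ ∑ A, w A * (Real.log (1 + I.uncoveredCost σ / Est) +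
        (I.uncoveredCost (I.nextState Est η T σ e A) - I.uncoveredCost σ) /
          (I.uncoveredCost σ + Est)) :=
      Finset.sum_le_sum fun A _ => mul_le_mul_of_nonneg_left
        (log_one_add_div_le hΦ (I.uncoveredCost_nonneg _) hEst) (hw A)
    _ = Real.log (1 + I.uncoveredCost σ / Est) +
        (∑ A, w A * I.uncoveredCost (I.nextState Est η T σ e A) - I.uncoveredCost σ) /
          (I.uncoveredCost σ + Est) := by
      simp only [mul_add, Finset.sum_add_distrib, ← Finset.sum_mul, hone, one_mul,
        mul_div_assoc', mul_sub, ← Finset.sum_div, Finset.sum_sub_distrib]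
    _ ≤ Real.log (1 + I.uncoveredCost σ / Est) +
        (-(I.residual σ.bought e / 2 * I.fractionalCoverage Est σ)) /
          (I.uncoveredCost σ + Est) := by
      gcongr
      linarith
    _ = _ := by ring

/-- The amount paid so far plus the amount that the potential still allows. -/
noncomputable def budget (I : SetCoverInstance m n) (Est η : ℝ) (F : Finset (Fin m))
    (σ : State m n) : ℝ :=
  σ.paid + 2 * Est * I.potential Est η F σ

theorem Inv.budget_nonneg {F : Finset (Fin m)} (h : I.Inv Est σ) (hEst : 0 < Est) (hη : 0 < η)
    (hF : I.costOf F ≤ Est) : 0 ≤ I.budget Est η F σ := by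
  have h1 := h.potential_nonneg hEst hη hF
  have h2 := (I.costOf_nonneg σ.bought).trans h.cost_le
  unfold budget
  positivity

theorem Inv.sum_budget_nextState_le (h : I.Inv Est σ) (hEst : 0 < Est) (hη : 0 < η) (hη1 : η ≤ 1)
    (hopt : I.opt ≤ Est) (T : I.TieBreaking Est) {F : Finset (Fin m)} (hF : I.IsCover F)
    (hFc : I.costOf F ≤ Est) {e : Fin n} (he : e ∈ σ.unseen) :
    ∑ A, sampleWeight (I.sampleProb Est σ e) A * I.budget Est η F (I.nextState Est η T σ e A) ≤
      I.budget Est η F σ + 2 * Est * (2 * I.gain Est (I.residual σ.bought e) e σ.weights -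
        2 * (I.residual σ.bought e * I.fractionalCoverage Est σ / (I.uncoveredCost σ + Est)) -
        2 / σ.unseen.card) := by
  have hpaid := h.sum_paid_nextState_le (η := η) hEst T e
  have hlog := h.sum_log_nextState_le (η := η) hEst hopt T e
  have hdiv := h.residual_le_divergence_sub hEst hη hη1 T hF hFc e ∅
  have hone := sum_sampleWeight (I.sampleProb Est σ e)
  have hcard : (harmonic σ.unseen.card : ℝ) =
      (harmonic (σ.unseen.erase e).card : ℝ) + 1 / σ.unseen.card := by
    rw [← Finset.card_erase_add_one he, harmonic_succ]
    push_cast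
    rw [one_div]
  -- The new weights and unseen set do not depend on the sample, so they are evaluated at `∅`; only
  -- the logarithm is random.
  have hconst : ∀ A, I.potential Est η F (I.nextState Est η T σ e A) =
      (1 / η * uKL (I.rescale Est (indicator F))
        (I.rescale Est (I.nextState Est η T σ e ∅).weights) +
        2 * (harmonic (σ.unseen.erase e).card : ℝ)) +
      4 * Real.log (1 + I.uncoveredCost (I.nextState Est η T σ e A) / Est) := by
    intro A
    simp only [potential, SetCoverInstance.nextState]
    ring
  have hsplit : ∑ A, sampleWeight (I.sampleProb Est σ e) A *
      I.budget Est η F (I.nextState Est η T σ e A) =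
      ∑ A, sampleWeight (I.sampleProb Est σ e) A * (I.nextState Est η T σ e A).paid +
      2 * Est * ((1 / η * uKL (I.rescale Est (indicator F))
        (I.rescale Est (I.nextState Est η T σ e ∅).weights) +
        2 * (harmonic (σ.unseen.erase e).card : ℝ)) +
      4 * ∑ A, sampleWeight (I.sampleProb Est σ e) A *
        Real.log (1 + I.uncoveredCost (I.nextState Est η T σ e A) / Est)) := by
    set c := 1 / η * uKL (I.rescale Est (indicator F))
        (I.rescale Est (I.nextState Est η T σ e ∅).weights) +
        2 * (harmonic (σ.unseen.erase e).card : ℝ)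
    have hc : c = ∑ A, sampleWeight (I.sampleProb Est σ e) A * c := by
      rw [← Finset.sum_mul, hone, one_mul]
    conv_rhs => rw [hc]
    rw [Finset.mul_sum, ← Finset.sum_add_distrib, Finset.mul_sum, ← Finset.sum_add_distrib]
    refine Finset.sum_congr rfl fun A _ => ?_
    rw [budget, hconst]
    ring
  rw [hsplit, budget, potential, hcard]
  have hres : 2 * I.residual σ.bought e = 2 * Est * (I.residual σ.bought e / Est) := by
    field_simp
  have hE : 0 ≤ 2 * Est := by positivity
  rw [hres] at hpaid
  have h4 : ∀ a b c d x y : ℝ, a ≤ x + 2 * Est * b → b + c ≤ d → y = x + 2 * Est * d →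
      a + 2 * Est * c ≤ y := by
    intro a b c d x y h1 h2 h3
    have := mul_le_mul_of_nonneg_left h2 hE
    linarith
  refine h4 _ _ _ (1 / η * uKL (I.rescale Est (indicator F)) (I.rescale Est σ.weights) +
      2 * I.gain Est (I.residual σ.bought e) e σ.weights +
      2 * (harmonic (σ.unseen.erase e).card : ℝ) +
      4 * (Real.log (1 + I.uncoveredCost σ / Est) -
        I.residual σ.bought e / 2 * I.fractionalCoverage Est σ / (I.uncoveredCost σ + Est)))
      _ _ hpaid ?_ ?_
  · linarith
  · ring

/-- The budget does not increase in expectation over one time step. -/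
theorem Inv.average_budget_le (h : I.Inv Est σ) (hEst : 0 < Est) (hη : 0 < η) (hη1 : η ≤ 1)
    (hopt : I.opt ≤ Est) (T : I.TieBreaking Est) {F : Finset (Fin m)} (hF : I.IsCover F)
    (hFc : I.costOf F ≤ Est) (hne : σ.unseen.Nonempty) :
    ∑ e ∈ σ.unseen, (σ.unseen.card : ℝ)⁻¹ * ∑ A, sampleWeight (I.sampleProb Est σ e) A *
      I.budget Est η F (I.nextState Est η T σ e A) ≤ I.budget Est η F σ := by
  have hr : (0 : ℝ) < σ.unseen.card := by exact_mod_cast hne.card_pos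
  have hΦ := I.uncoveredCost_nonneg σ
  obtain ⟨hM, hM0⟩ := fractionalCoverage_mul_le hEst h
  rw [← Finset.mul_sum, inv_mul_le_iff₀ hr]
  refine (Finset.sum_le_sum fun e he =>
    h.sum_budget_nextState_le hEst hη hη1 hopt T hF hFc he).trans ?_
  rw [Finset.sum_add_distrib, Finset.sum_const, nsmul_eq_mul, ← Finset.mul_sum]
  simp only [Finset.sum_sub_distrib, ← Finset.mul_sum, ← Finset.sum_div, ← Finset.sum_mul,
    Finset.sum_const, nsmul_eq_mul]
  change _ + 2 * Est * (2 * I.fractionalCoverage Est σ -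
    2 * (I.uncoveredCost σ * I.fractionalCoverage Est σ / (I.uncoveredCost σ + Est)) - _) ≤ _
  -- The left side equals M Est/(Φ + Est), and M Est ≤ Φ. The resulting 1 is what the drop of the
  -- harmonic number absorbs.
  have hle : I.fractionalCoverage Est σ -
      I.uncoveredCost σ * I.fractionalCoverage Est σ / (I.uncoveredCost σ + Est) ≤ 1 := by
    have e : I.fractionalCoverage Est σ -
        I.uncoveredCost σ * I.fractionalCoverage Est σ / (I.uncoveredCost σ + Est) =
        I.fractionalCoverage Est σ * Est / (I.uncoveredCost σ + Est) := by
      field_simp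
      ring
    rw [e, div_le_one (by positivity)]
    linarith
  have hcancel : (σ.unseen.card : ℝ) * 2 / σ.unseen.card = 2 := by field_simp
  rw [hcancel]
  nlinarith

end Potential

/-! ### Expectations over `PMF` -/

section Expectation

/-- The expectation of a nonnegative function. -/
noncomputable def expect {α : Type*} (P : PMF α) (f : α → ENNReal) : ENNReal := ∑' a, P a * f a

theorem expect_pure {α : Type*} (a : α) (f : α → ENNReal) : expect (PMF.pure a) f = f a := by
  rw [expect, tsum_eq_single a]
  · simp
  · intro b hb
    simp [PMF.pure_apply, hb]

theorem expect_bind {α β : Type*} (P : PMF α) (Q : α → PMF β) (f : β → ENNReal) :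
    expect (P.bind Q) f = expect P fun a => expect (Q a) f := by
  simp only [expect, PMF.bind_apply, ← ENNReal.tsum_mul_right, ← ENNReal.tsum_mul_left]
  rw [ENNReal.tsum_comm]
  simp only [mul_assoc]

theorem expect_map {α β : Type*} (P : PMF α) (g : α → β) (f : β → ENNReal) :
    expect (P.map g) f = expect P (f ∘ g) := by
  rw [PMF.map, expect_bind]
  simp only [Function.comp_def, expect_pure]

theorem expect_mono_on_support {α : Type*} (P : PMF α) {f g : α → ENNReal}
    (h : ∀ a ∈ P.support, f a ≤ g a) : expect P f ≤ expect P g := by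
  refine ENNReal.tsum_le_tsum fun a => ?_
  by_cases ha : a ∈ P.support
  · exact mul_le_mul_right (h a ha) _
  · simp [(PMF.apply_eq_zero_iff P a).2 ha]

theorem expect_uniformOfFinset {α : Type*} (s : Finset α) (hs : s.Nonempty) (f : α → ENNReal) :
    expect (PMF.uniformOfFinset s hs) f = ∑ a ∈ s, (s.card : ENNReal)⁻¹ * f a := by
  rw [expect, tsum_eq_sum (s := s)]
  · exact Finset.sum_congr rfl fun a ha => by rw [PMF.uniformOfFinset_apply_of_mem hs ha]
  · intro a ha
    rw [PMF.uniformOfFinset_apply_of_notMem hs ha, zero_mul]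

theorem expect_sampleSets {q : Fin m → ℝ} (h0 : ∀ S, 0 ≤ q S) (h1 : ∀ S, q S ≤ 1)
    {f : Finset (Fin m) → ℝ} (hf : ∀ A, 0 ≤ f A) :
    expect (sampleSets q) (fun A => ENNReal.ofReal (f A)) =
      ENNReal.ofReal (∑ A, sampleWeight q A * f A) := by
  have hw := sampleWeight_nonneg h0 h1
  rw [expect, tsum_fintype, ENNReal.ofReal_sum_of_nonneg fun A _ => mul_nonneg (hw A) (hf A)]
  exact Finset.sum_congr rfl fun A _ => by
    rw [sampleSets_apply h0 h1, ENNReal.ofReal_mul (hw A)]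

end Expectation

/-! ### Iterating the step and bounding the initial budget -/

section Run

variable {I : SetCoverInstance m n} {Est η : ℝ} {σ : State m n}

theorem Inv.expect_budget_step_le (h : I.Inv Est σ) (hEst : 0 < Est) (hη : 0 < η) (hη1 : η ≤ 1)
    (hopt : I.opt ≤ Est) (T : I.TieBreaking Est) {F : Finset (Fin m)} (hF : I.IsCover F)
    (hFc : I.costOf F ≤ Est) :
    expect (I.step Est η T σ) (fun τ => ENNReal.ofReal (I.budget Est η F τ)) ≤
      ENNReal.ofReal (I.budget Est η F σ) := by
  by_cases hne : σ.unseen.Nonempty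
  · have hr : (0 : ℝ) < σ.unseen.card := by exact_mod_cast hne.card_pos
    have hb : ∀ e A, 0 ≤ I.budget Est η F (I.nextState Est η T σ e A) := fun e A =>
      (h.nextState hEst hη T e A).budget_nonneg hEst hη hFc
    rw [step, dif_pos hne, expect_bind, expect_uniformOfFinset]
    refine le_trans (le_of_eq ?_) (ENNReal.ofReal_le_ofReal
      (h.average_budget_le hEst hη hη1 hopt T hF hFc hne))
    have hs : ∀ e, 0 ≤ ∑ A, sampleWeight (I.sampleProb Est σ e) A *
        I.budget Est η F (I.nextState Est η T σ e A) := fun e =>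
      Finset.sum_nonneg fun A _ => mul_nonneg (sampleWeight_nonneg (h.sampleProb_nonneg hEst e)
        (h.sampleProb_le_one hEst hopt e) A) (hb e A)
    rw [ENNReal.ofReal_sum_of_nonneg fun e _ => mul_nonneg (inv_nonneg.2 hr.le) (hs e)]
    refine Finset.sum_congr rfl fun e _ => ?_
    rw [ENNReal.ofReal_mul (inv_nonneg.2 hr.le), ENNReal.ofReal_inv_of_pos hr,
      ENNReal.ofReal_natCast, expect_map]
    exact congrArg _ (expect_sampleSets (h.sampleProb_nonneg hEst e)
      (h.sampleProb_le_one hEst hopt e) (hb e))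
  · rw [step, dif_neg hne, expect_pure]

theorem mem_support_step {T : I.TieBreaking Est} {τ : State m n}
    (hτ : τ ∈ (I.step Est η T σ).support) :
    (∃ e ∈ σ.unseen, ∃ A, τ = I.nextState Est η T σ e A) ∨ (σ.unseen = ∅ ∧ τ = σ) := by
  by_cases hne : σ.unseen.Nonempty
  · rw [step, dif_pos hne, PMF.mem_support_bind_iff] at hτ
    obtain ⟨e, he, hτ⟩ := hτ
    obtain ⟨A, -, rfl⟩ := (PMF.mem_support_map_iff _ _ _).1 hτ
    exact Or.inl ⟨e, (PMF.mem_support_uniformOfFinset_iff hne e).1 he, A, rfl⟩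
  · rw [step, dif_neg hne, PMF.mem_support_pure_iff] at hτ
    exact Or.inr ⟨Finset.not_nonempty_iff_eq_empty.1 hne, hτ⟩

/-- The count shows that no element is unseen at time n, so the invariant then says that everything
is covered. -/
theorem inv_of_mem_support_run (hEst : 0 < Est) (hη : 0 < η) (hm : 0 < m) (T : I.TieBreaking Est)
    (t : ℕ) : ∀ σ ∈ (I.run Est η T t).support, I.Inv Est σ ∧ σ.unseen.card = n - t := by
  induction t with
  | zero =>
    intro σ hσ
    rw [run, PMF.mem_support_pure_iff] at hσ
    subst hσ
    exact ⟨Inv.init I hEst hη hm, by simp [init]⟩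
  | succ t ih =>
    intro τ hτ
    rw [run, PMF.mem_support_bind_iff] at hτ
    obtain ⟨σ, hσ, hτ⟩ := hτ
    obtain ⟨hinv, hcard⟩ := ih σ hσ
    rcases mem_support_step hτ with ⟨e, he, A, rfl⟩ | ⟨hemp, rfl⟩
    · refine ⟨hinv.nextState hEst hη T e A, ?_⟩
      have := Finset.card_erase_of_mem he
      simp only [nextState]
      omega
    · refine ⟨hinv, ?_⟩
      rw [hemp, Finset.card_empty] at hcard ⊢
      omega

theorem expect_budget_run_le (hEst : 0 < Est) (hη : 0 < η) (hη1 : η ≤ 1) (hm : 0 < m)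
    (hopt : I.opt ≤ Est) (T : I.TieBreaking Est) {F : Finset (Fin m)} (hF : I.IsCover F)
    (hFc : I.costOf F ≤ Est) (t : ℕ) :
    expect (I.run Est η T t) (fun τ => ENNReal.ofReal (I.budget Est η F τ)) ≤
      ENNReal.ofReal (I.budget Est η F (I.init Est η)) := by
  induction t with
  | zero => rw [run, expect_pure]
  | succ t ih =>
    rw [run, expect_bind]
    exact (expect_mono_on_support _ fun σ hσ =>
      (inv_of_mem_support_run hEst hη hm T t σ hσ).1.expect_budget_step_le hEst hη hη1 hopt T hF
        hFc).trans ih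

/-- Each x S is at most 1, so log(m · x S) ≤ log m; the masses 1/m add up to 1. -/
theorem uKL_uniform_le (hm : 0 < m) {x : Fin m → ℝ} (hx : ∀ S, 0 ≤ x S) (hsum : ∑ S, x S ≤ 1) :
    uKL x (fun _ => 1 / (m : ℝ)) ≤ Real.log m + 1 := by
  have hm' : (0 : ℝ) < m := by exact_mod_cast hm
  have hlogm : 0 ≤ Real.log m := Real.log_nonneg (by exact_mod_cast hm)
  calc uKL x (fun _ => 1 / (m : ℝ)) ≤ ∑ S, (x S * Real.log m + 1 / m) := by
        refine Finset.sum_le_sum fun S _ => ?_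
        have hx1 : x S ≤ 1 :=
          (Finset.single_le_sum (fun R _ => hx R) (Finset.mem_univ S)).trans hsum
        have hlog : x S * Real.log (x S / (1 / m)) ≤ x S * Real.log m := by
          rcases (hx S).eq_or_lt with h0 | hpos
          · simp [← h0]
          · refine mul_le_mul_of_nonneg_left (Real.log_le_log (by positivity) ?_) hpos.le
            rw [div_div_eq_mul_div, div_one]
            nlinarith
        change x S * Real.log (x S / (1 / m)) - x S + 1 / m ≤ _
        linarith [hx S]
    _ = (∑ S, x S) * Real.log m + 1 := by
        rw [Finset.sum_add_distrib, ← Finset.sum_mul]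
        simp [hm'.ne']
    _ ≤ _ := by nlinarith

theorem budget_init_le (hEst : 0 < Est) (hη : 0 < η) (hmn : 2 ≤ m * n) (hopt : I.opt ≤ Est)
    {F : Finset (Fin m)} (hFc : I.costOf F ≤ Est) :
    I.budget Est η F (I.init Est η) ≤ 2 * Est * ((3 / η + 14) * Real.log ((m : ℝ) * n)) := by
  have hm : 0 < m := Nat.pos_of_ne_zero fun h => by simp [h] at hmn
  have hn : 0 < n := Nat.pos_of_ne_zero fun h => by simp [h] at hmn
  have hm1 : (1 : ℝ) ≤ m := by exact_mod_cast hm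
  have hn1 : (1 : ℝ) ≤ n := by exact_mod_cast hn
  have hmn2 : (2 : ℝ) ≤ m * n := by exact_mod_cast hmn
  have hlogm : 0 ≤ Real.log m := Real.log_nonneg hm1
  have hlogn : 0 ≤ Real.log n := Real.log_nonneg hn1
  have hL : Real.log ((m : ℝ) * n) = Real.log m + Real.log n :=
    Real.log_mul (by positivity) (by positivity)
  have hL2 : Real.log 2 ≤ Real.log ((m : ℝ) * n) := Real.log_le_log two_pos hmn2
  have hlog2 := Real.log_two_gt_d9
  have hq := I.indicator_mem_weightSet hFc
  have hmpos : ∀ S : Fin m, (0 : ℝ) < (fun _ => 1 / (m : ℝ)) S := fun _ => by positivity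
  -- The initial weights come from a step with zero gradient, a Bregman projection, which by the
  -- generalized Pythagorean inequality does not increase the divergence of an admissible point.
  have hdiv : uKL (I.rescale Est (indicator F)) (I.rescale Est (I.init Est η).weights) ≤
      Real.log m + 1 := by
    have hs := I.isMirrorStep_mirrorStep hEst.le η (fun _ => 1 / (m : ℝ)) 0
    have hfo := hs.first_order hEst hη hmpos hq
    have hnn := uKL_nonneg (I.rescale_nonneg hEst hs.1) hmpos
    have hu := uKL_uniform_le hm (I.rescale_nonneg hEst hq) (by
      simp only [rescale]
      rw [← Finset.sum_div, div_le_one hEst]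
      exact hq.2)
    simp only [Pi.zero_apply, zero_mul, Finset.sum_const_zero, mul_zero] at hfo
    change uKL _ (I.rescale Est (I.mirrorStep Est η (fun _ => 1 / (m : ℝ)) 0)) ≤ _
    linarith
  have hΦ : I.uncoveredCost (I.init Est η) / Est ≤ n := by
    rw [div_le_iff₀ hEst]
    refine (Finset.sum_le_card_nsmul _ _ Est fun f _ => (I.residual_le_opt _ f).trans hopt).trans ?_
    simp [init]
  have hΦlog : Real.log (1 + I.uncoveredCost (I.init Est η) / Est) ≤ 2 * Real.log ((m : ℝ) * n) := by
    have h0 := div_nonneg (I.uncoveredCost_nonneg (I.init Est η)) hEst.le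
    calc _ ≤ Real.log (2 * n) := Real.log_le_log (by positivity) (by linarith)
      _ = Real.log 2 + Real.log n := Real.log_mul two_ne_zero (by positivity)
      _ ≤ _ := by linarith
  have hH : (harmonic (I.init Est η).unseen.card : ℝ) ≤ 1 + Real.log n := by
    simpa [init] using harmonic_le_one_add_log n
  -- Since mn ≥ 2 gives 1 ≤ 2L, the divergence is at most 3L, the logarithm contributes 4 · 2L and
  -- the harmonic number 2 · 3L, whence 3/η + 14.
  set L := Real.log ((m : ℝ) * n)
  have hdivL : 1 / η * uKL (I.rescale Est (indicator F)) (I.rescale Est (I.init Est η).weights) ≤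
      3 / η * L := by
    calc _ ≤ 1 / η * (3 * L) := mul_le_mul_of_nonneg_left (by linarith) (by positivity)
      _ = _ := by ring
  have hpaid : (I.init Est η).paid = 0 := rfl
  rw [budget, hpaid, zero_add]
  refine mul_le_mul_of_nonneg_left ?_ (by positivity)
  rw [potential]
  linarith

end Run

end SetCoverInstance

theorem mainTheorem1 (η : ℝ) (hη_pos : 0 < η) (hη_le : η ≤ 1) :
    ∃ C : ℝ, 0 < C ∧
      ∀ (m n : ℕ), 2 ≤ m * n →
      ∀ (I : SetCoverInstance m n) (Est : ℝ), I.opt ≤ Est → Est ≤ 2 * I.opt →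
      ∀ T : I.TieBreaking Est,
        (∀ σ ∈ (I.roscOco Est η T).support,
          I.IsCover σ.bought ∧ I.costOf σ.bought ≤ σ.paid) ∧
        SetCoverInstance.expectedPaid (I.roscOco Est η T) ≤
          ENNReal.ofReal (C * Real.log ((m : ℝ) * (n : ℝ)) * I.opt) := by
  -- The factor 4 is the 2 of the budget times the 2 from Est ≤ 2 opt.
  refine ⟨4 * (3 / η + 14), by positivity, fun m n hmn I Est hopt hEst2 T => ?_⟩
  have hm : 0 < m := Nat.pos_of_ne_zero fun h => by simp [h] at hmn
  have hn : 0 < n := Nat.pos_of_ne_zero fun h => by simp [h] at hmn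
  have hopt_pos : 0 < I.opt := (I.kappa_pos ⟨0, hn⟩).trans_le (I.kappa_le_opt _)
  have hEst : 0 < Est := hopt_pos.trans_le hopt
  have hinv := SetCoverInstance.inv_of_mem_support_run hEst hη_pos hm T n
  obtain ⟨F, hF, hFopt⟩ := I.exists_isCover_costOf_eq_opt
  have hFc : I.costOf F ≤ Est := hFopt.trans_le hopt
  refine ⟨fun σ hσ => ?_, ?_⟩
  · obtain ⟨h, hcard⟩ := hinv σ hσ
    rw [Nat.sub_self, Finset.card_eq_zero] at hcard
    exact ⟨fun e => h.covered e (by simp [hcard]), h.cost_le⟩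
  · calc SetCoverInstance.expectedPaid (I.roscOco Est η T)
        ≤ SetCoverInstance.expect (I.roscOco Est η T)
            fun τ => ENNReal.ofReal (I.budget Est η F τ) := by
          refine SetCoverInstance.expect_mono_on_support _ fun σ hσ =>
            ENNReal.ofReal_le_ofReal (le_add_of_nonneg_right ?_)
          exact mul_nonneg (by positivity) ((hinv σ hσ).1.potential_nonneg hEst hη_pos hFc)
      _ ≤ ENNReal.ofReal (I.budget Est η F (I.init Est η)) :=
          SetCoverInstance.expect_budget_run_le hEst hη_pos hη_le hm hopt T hF hFc n
      _ ≤ _ := by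
          refine ENNReal.ofReal_le_ofReal
            ((SetCoverInstance.budget_init_le hEst hη_pos hmn hopt hFc).trans ?_)
          have hL : 0 ≤ Real.log ((m : ℝ) * n) :=
            Real.log_nonneg (by exact_mod_cast Nat.one_le_of_lt hmn)
          have h3 : 0 ≤ (3 / η + 14) * Real.log ((m : ℝ) * n) := by positivity
          nlinarith [mul_le_mul_of_nonneg_right hEst2 h3]
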